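/- All graphs are finite and simple. A dominating set of a graph $G$ is a set $D \subseteq V(G)$ such that every vertex of $V(G) \setminus D$ is adjacent to at least one vertex of $D$. The TARS-graph $\varepsilon(G)$ is the graph whose vertices are the dominating sets of $G$, where two dominating sets $X$ and $Y$ are adjacent if and only if either $Y$ can be obtained from $X$ by adding or deleting a single vertex of $G$, or there exist $u \in X$ and $v \in Y \setminus X$ that are adjacent in $G$ such that $Y = (X \cup \{v\}) \setminus \{u\}$. A graph on $n$ vertices is pancyclic if it contains a cycle of length $\ell$ for every integer $\ell$ with $3 \le \ell \le n$. A graph $H'$ is obtained from a graph $H$ by Operation B if $H$ has vertices $u, v, x$ with $u \ne v$ and $N(u) = N(v) = \{x\}$ such that $H' = H - \{v\}$ (up to isomorphism). **Theorem.** Let $H$ and $H'$ be graphs such that $H'$ is obtained from $H$ by Operation B. If $\varepsilon(H')$ is pancyclic, then $\varepsilon(H)$ is pancyclic. -/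

import Mathlib

/-- `D` is a dominating set of `G`: every vertex outside `D` has a neighbour in `D`. -/
def IsDominatingSet {V : Type*} (G : SimpleGraph V) (D : Set V) : Prop :=
  ∀ w, w ∉ D → ∃ d ∈ D, G.Adj w d

/-- `Y` is obtained from `X` by adding or deleting a single vertex. -/
def IsTokenAddRemove {V : Type*} (X Y : Set V) : Prop :=
  (∃ w, w ∉ X ∧ Y = X ∪ {w}) ∨ (∃ w, w ∈ X ∧ Y = X \ {w})

/-- `Y` is obtained from `X` by sliding a token along an edge of `G`. -/
def IsTokenSlide {V : Type*} (G : SimpleGraph V) (X Y : Set V) : Prop :=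
  ∃ u v, u ∈ X ∧ v ∈ Y \ X ∧ G.Adj u v ∧ Y = (X ∪ {v}) \ {u}

theorem IsTokenAddRemove.symm {V : Type*} {X Y : Set V} (h : IsTokenAddRemove X Y) :
    IsTokenAddRemove Y X := by
  rcases h with ⟨w, hw, rfl⟩ | ⟨w, hw, rfl⟩
  · refine Or.inr ⟨w, by simp, ?_⟩
    ext z
    by_cases hz : z = w <;> simp_all
  · refine Or.inl ⟨w, by simp, ?_⟩
    ext z
    by_cases hz : z = w <;> simp_all

theorem IsTokenSlide.symm {V : Type*} {G : SimpleGraph V} {X Y : Set V}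
    (h : IsTokenSlide G X Y) : IsTokenSlide G Y X := by
  obtain ⟨u, v, hu, ⟨hvY, hvX⟩, huv, rfl⟩ := h
  refine ⟨v, u, hvY, ⟨hu, by simp⟩, huv.symm, ?_⟩
  ext z
  by_cases hz : z = u <;> by_cases hz' : z = v <;> simp_all

theorem not_isTokenAddRemove_self {V : Type*} (X : Set V) : ¬ IsTokenAddRemove X X := by
  rintro (⟨w, hw, h⟩ | ⟨w, hw, h⟩)
  · exact hw (h ▸ Or.inr rfl)
  · rw [h] at hw
    exact hw.2 rfl

theorem not_isTokenSlide_self {V : Type*} (G : SimpleGraph V) (X : Set V) :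
    ¬ IsTokenSlide G X X := by
  rintro ⟨_, _, _, hv, _⟩
  exact hv.2 hv.1

/-- The TARS-graph of `G`: its vertices are the dominating sets of `G`, and two of them are
adjacent if they differ by one token addition or removal, or by one token slide. -/
def tarsGraph {V : Type*} (G : SimpleGraph V) :
    SimpleGraph {D : Set V // IsDominatingSet G D} where
  Adj X Y := IsTokenAddRemove X.1 Y.1 ∨ IsTokenSlide G X.1 Y.1
  symm := ⟨fun _ _ h => h.imp IsTokenAddRemove.symm IsTokenSlide.symm⟩
  loopless := ⟨fun X h => h.elim (not_isTokenAddRemove_self X.1) (not_isTokenSlide_self G X.1)⟩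

/-- A finite graph on `n` vertices is pancyclic if it has a cycle of every length
`ℓ` with `3 ≤ ℓ ≤ n`. -/
def IsPancyclic {V : Type*} [Finite V] (G : SimpleGraph V) : Prop :=
  ∀ ℓ : ℕ, 3 ≤ ℓ → ℓ ≤ Nat.card V → ∃ (a : V) (p : G.Walk a a), p.IsCycle ∧ p.length = ℓ

/-- `H'` is obtained from `H` by Operation B: `H` has two distinct leaves `u`, `v` with the same
neighbour `x`, and `H'` is (up to isomorphism) the graph `H - {v}`. -/
def IsOperationB {V W : Type*} (H : SimpleGraph V) (H' : SimpleGraph W) : Prop :=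
  ∃ u v x : V, u ≠ v ∧ H.neighborSet u = {x} ∧ H.neighborSet v = {x} ∧
    Nonempty (H' ≃g H.induce {w | w ≠ v})

open SimpleGraph

/-! ### Rerouting cycles, and matchings carried by a cycle -/

namespace SimpleGraph

variable {V : Type*} {G : SimpleGraph V}

/-! Let `n` be the order of the TARS-graph of `H'`. The dominating sets of `H` containing `v` form a
copy of that graph: whenever `x` is dominated by `v`, it is in the set or `u` is, so `v` is never
needed. The dominating sets avoiding `v` all contain `x`; they are the sets `κ p = p \ {v}`, where
`p = ι p` runs over the set `X` of dominating sets containing both `v` and `x`. Toggling `u` is an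
involution `τ` of `X`, which makes the second layer a union of rungs `κ p`, `κ (τ p)`.

Lengths up to `n` come from the copy. For longer ones, a cycle of length `n` or `n - 1` in the copy
(chosen by parity) absorbs rungs, two vertices at a time. The engine is a matching `μ` of `X` made
of edges of the cycle: an edge `ι p`, `ι (μ p)` lets the cycle dip into the second layer, and a rung
already absorbed lets it pass on to the rung of a `μ`-partner (`Absorbs.extend`). When propagation
stops, a new start is made (`Absorbs.start`), and `Absorbs.exists_isCycle` iterates. If both ends of
a rung are unmatched, it is entered from a neighbour outside both layers.
`DoubleLayer.exists_isCycle` deals with the vertex missed by a cycle of length `n - 1`. -/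

theorem Walk.IsCycle.exists_isPath_of_mem_edges {a p q : V} {c : G.Walk a a} (hc : c.IsCycle)
    (h : s(p, q) ∈ c.edges) :
    ∃ t : G.Walk q p, t.IsPath ∧ t.length + 1 = c.length ∧ (∀ w, w ∈ t.support ↔ w ∈ c.support) ∧
      ∀ e, e ∈ c.edges ↔ e = s(p, q) ∨ e ∈ t.edges := by
  classical
  have hp : p ∈ c.support := c.fst_mem_support_of_mem_edges h
  have key : ∀ c' : G.Walk p p, c'.IsCycle → c'.length = c.length →
      (∀ w, w ∈ c'.support ↔ w ∈ c.support) → (∀ e, e ∈ c'.edges ↔ e ∈ c.edges) → ∀ q',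
      s(p, q') ∈ c'.edges → c'.snd = q' →
      ∃ t : G.Walk q' p, t.IsPath ∧ t.length + 1 = c.length ∧
      (∀ w, w ∈ t.support ↔ w ∈ c.support) ∧
      ∀ e, e ∈ c.edges ↔ e = s(p, q') ∨ e ∈ t.edges := by
    intro c' hc' hl hs he q' hq hsnd
    cases c' with
    | nil => simp at hc'
    | cons hadj t =>
      simp only [Walk.snd_cons] at hsnd
      subst hsnd
      refine ⟨t, (Walk.cons_isCycle_iff _ _).1 hc' |>.1, by simpa using hl, ?_, ?_⟩
      · intro w
        rw [← hs]
        simp only [Walk.support_cons, List.mem_cons]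
        constructor
        · exact Or.inr
        · rintro (rfl | h')
          · exact t.end_mem_support
          · exact h'
      · intro e
        rw [← he]
        simp
  have hc₀ : (c.rotate p hp).IsCycle := hc.rotate hp
  have he₀ : ∀ e, e ∈ (c.rotate p hp).edges ↔ e ∈ c.edges := fun e =>
    (c.rotate_edges p hp).perm.mem_iff
  by_cases hsnd : (c.rotate p hp).snd = q
  · exact key _ hc₀ (by simp) (by simp) he₀ q ((he₀ _).2 h) hsnd
  -- Only two edges of the cycle meet `p`, the first and the last, so `q` comes second after
  -- reversal.
  · refine key _ hc₀.reverse (by simp) (by simp) (by simpa using he₀) q (by simpa [he₀] using h) ?_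
    rw [Walk.snd_reverse]
    have h' := (he₀ _).2 h
    generalize c.rotate p hp = c₀ at hc₀ hsnd h'
    cases c₀ with
    | nil => simp at hc₀
    | cons hadj t =>
      rw [Walk.cons_isCycle_iff] at hc₀
      simp only [Walk.snd_cons] at hsnd
      simp only [Walk.edges_cons, List.mem_cons, Sym2.congr_right] at h'
      have ht := h'.resolve_left (Ne.symm hsnd)
      rw [hc₀.1.eq_penultimate_of_mem_edges ht, Walk.penultimate_cons_of_not_nil]
      intro hn
      cases hn
      simp at ht

/-- The edge `p q` is replaced by the path `p, y, z, q`. Every absorption below is an instance;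
tracking the surviving edges is what allows iteration. -/
theorem Walk.IsCycle.exists_insert_pair {a p q y z : V} {c : G.Walk a a} (hc : c.IsCycle)
    (h : s(p, q) ∈ c.edges) (hy : y ∉ c.support) (hz : z ∉ c.support)
    (hpy : G.Adj p y) (hyz : G.Adj y z) (hzq : G.Adj z q) :
    ∃ (b : V) (d : G.Walk b b), d.IsCycle ∧ d.length = c.length + 2 ∧
      (∀ w, w ∈ d.support ↔ w ∈ c.support ∨ w = y ∨ w = z) ∧
      (∀ e ∈ c.edges, e ≠ s(p, q) → e ∈ d.edges) ∧
      s(p, y) ∈ d.edges ∧ s(y, z) ∈ d.edges ∧ s(z, q) ∈ d.edges := by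
  obtain ⟨t, ht, hl, hs, he⟩ := hc.exists_isPath_of_mem_edges h
  have hy' : y ∉ t.support := by rwa [hs]
  have hz' : z ∉ t.support := by rwa [hs]
  have hp : p ∈ t.support := t.end_mem_support
  have hyzne := hyz.ne
  refine ⟨p, .cons hpy (.cons hyz (.cons hzq t)), ?_, ?_, ?_, ?_, by simp, by simp, by simp⟩
  · rw [Walk.cons_isCycle_iff]
    refine ⟨by simp [ht, hy', hz', hyzne], ?_⟩
    simp only [Walk.edges_cons, List.mem_cons, not_or]
    refine ⟨?_, ?_, fun h' => hy' (t.snd_mem_support_of_mem_edges h')⟩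
    · intro h'
      rw [Sym2.eq_iff] at h'
      rcases h' with ⟨h1, h2⟩ | ⟨h1, h2⟩
      · exact hpy.ne h1
      · exact hz' (h1 ▸ hp)
    · intro h'
      rw [Sym2.eq_iff] at h'
      rcases h' with ⟨h1, h2⟩ | ⟨h1, h2⟩
      · exact hz' (h1 ▸ hp)
      · exact hyzne h2
  · simp only [Walk.length_cons]; omega
  · intro w
    rw [← hs]
    simp only [Walk.support_cons, List.mem_cons]
    constructor
    · rintro (rfl | rfl | rfl | h')
      · exact Or.inl hp
      · simp
      · simp
      · exact Or.inl h'
    · tauto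
  · intro e hec hne
    have := (he e).1 hec
    simp only [Walk.edges_cons, List.mem_cons]
    tauto

/-- Greedy pairing along the path: two consecutive vertices of `ι` are matched and skipped,
otherwise one vertex is skipped. An element left single is followed by a vertex off `ι`, or ends the
path. -/
theorem Walk.IsPath.exists_matching {X : Type*} {ι : X → V} (hι : Function.Injective ι) {a b : V}
    {t : G.Walk a b} (ht : t.IsPath) :
    ∃ μ : X → X, Function.Involutive μ ∧ (∀ p, μ p ≠ p → s(ι p, ι (μ p)) ∈ t.edges) ∧
      ∀ p, ι p ∈ t.support → μ p = p →
        (∃ w, w ∉ Set.range ι ∧ s(w, ι p) ∈ t.edges) ∨ ι p = b := by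
  classical
  induction hn : t.length using Nat.strong_induction_on generalizing a with
  | _ n ih =>
  cases t with
  | nil => exact ⟨id, fun _ => rfl, fun p h => absurd rfl h, fun p h _ => Or.inr (by simpa using h)⟩
  | @cons _ a' _ h t =>
    rw [Walk.cons_isPath_iff] at ht
    rw [Walk.length_cons] at hn
    have mono : ∀ μ : X → X, Function.Involutive μ →
        (∀ p, μ p ≠ p → s(ι p, ι (μ p)) ∈ t.edges) →
        (∀ p, ι p ∈ t.support → μ p = p →
          (∃ w, w ∉ Set.range ι ∧ s(w, ι p) ∈ t.edges) ∨ ι p = b) →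
        (∀ p, ι p = a → a' ∉ Set.range ι) →
        ∃ μ : X → X, Function.Involutive μ ∧
          (∀ p, μ p ≠ p → s(ι p, ι (μ p)) ∈ (Walk.cons h t).edges) ∧
          ∀ p, ι p ∈ (Walk.cons h t).support → μ p = p →
            (∃ w, w ∉ Set.range ι ∧ s(w, ι p) ∈ (Walk.cons h t).edges) ∨ ι p = b := by
      intro μ h1 h2 h3 h4
      refine ⟨μ, h1, fun p hp => by simp [h2 p hp], fun p hp hμ => ?_⟩
      rw [Walk.support_cons, List.mem_cons] at hp
      rcases hp with hp | hp
      · exact Or.inl ⟨a', h4 p hp, by simp [hp, Sym2.eq_swap]⟩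
      · rcases h3 p hp hμ with ⟨w, hw, hw'⟩ | h'
        · exact Or.inl ⟨w, hw, by simp [hw']⟩
        · exact Or.inr h'
    by_cases hX : a ∈ Set.range ι ∧ a' ∈ Set.range ι
    · obtain ⟨⟨x, rfl⟩, ⟨x', rfl⟩⟩ := hX
      have hxx : x ≠ x' := fun h' => h.ne (by rw [h'])
      cases t with
      | nil =>
        refine ⟨Equiv.swap x x', Equiv.swap_apply_self x x', ?_, ?_⟩
        · intro p hp
          rcases eq_or_ne p x with rfl | h1
          · simp
          · rcases eq_or_ne p x' with rfl | h2
            · simp [Sym2.eq_swap]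
            · exact absurd (Equiv.swap_apply_of_ne_of_ne h1 h2) hp
        · intro p hp hμ
          simp only [Walk.support_cons, Walk.support_nil, List.mem_cons, List.not_mem_nil,
            or_false, hι.eq_iff] at hp
          rcases hp with rfl | rfl
          · simp [hxx.symm] at hμ
          · exact Or.inr rfl
      | @cons _ a'' _ h' t =>
        rw [Walk.cons_isPath_iff] at ht
        rw [Walk.length_cons] at hn
        obtain ⟨μ, h1, h2, h3⟩ := ih _ (by omega) ht.1.1 rfl
        have hxt : ι x ∉ t.support := fun h'' => ht.2 (by simp [h''])
        have fixed : ∀ p, ι p ∉ t.support → μ p = p := by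
          intro p hp
          by_contra hμ
          exact hp (t.fst_mem_support_of_mem_edges (h2 p hμ))
        have hμx := fixed x hxt
        have hμx' := fixed x' ht.1.2
        refine ⟨fun p => if p = x then x' else if p = x' then x else μ p, ?_, ?_, ?_⟩
        · intro p
          rcases eq_or_ne p x with rfl | hp1
          · simp [hxx.symm]
          · rcases eq_or_ne p x' with rfl | hp2
            · simp [hp1]
            · have hq1 : μ p ≠ x := fun h'' => hp1 (by rw [← h1 p, h'', hμx])
              have hq2 : μ p ≠ x' := fun h'' => hp2 (by rw [← h1 p, h'', hμx'])
              simp [hp1, hp2, hq1, hq2, h1 p]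
        · intro p hp
          rcases eq_or_ne p x with rfl | hp1
          · simp
          · rcases eq_or_ne p x' with rfl | hp2
            · simp [hp1, Sym2.eq_swap]
            · simp only [hp1, hp2, if_false] at hp ⊢
              simp [h2 p hp]
        · intro p hp hμ
          rcases eq_or_ne p x with rfl | hp1
          · simp [hxx.symm] at hμ
          · rcases eq_or_ne p x' with rfl | hp2
            · simp [hp1, hxx] at hμ
            · simp only [hp1, hp2, if_false] at hμ
              simp only [Walk.support_cons, List.mem_cons, hι.eq_iff, hp1, hp2, false_or] at hp
              rcases h3 p hp hμ with ⟨w, hw, hw'⟩ | h'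
              · exact Or.inl ⟨w, hw, by simp [hw']⟩
              · exact Or.inr h'
    · obtain ⟨μ, h1, h2, h3⟩ := ih _ (by omega) ht.1 rfl
      refine mono μ h1 h2 h3 fun p hp ha' => hX ⟨⟨p, hp⟩, ha'⟩

/-- The cycle is cut open at a vertex off `ι` if it has one, so that the exceptional end of the path
is not in `ι`. Otherwise the cycle lies within `ι`, and only that end can stay single. -/
theorem Walk.IsCycle.exists_matching {X : Type*} {ι : X → V} (hι : Function.Injective ι) {a : V}
    {c : G.Walk a a} (hc : c.IsCycle) :
    ∃ μ : X → X, Function.Involutive μ ∧ (∀ p, μ p ≠ p → s(ι p, ι (μ p)) ∈ c.edges) ∧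
      ∀ p, ι p ∈ c.support → μ p = p →
        (∃ w, w ∉ Set.range ι ∧ s(w, ι p) ∈ c.edges) ∨
        (∀ w ∈ c.support, w ∈ Set.range ι) ∧ ∀ q, ι q ∈ c.support → μ q = q → q = p := by
  classical
  have key : ∃ b, b ∈ c.support ∧ (b ∈ Set.range ι → ∀ w ∈ c.support, w ∈ Set.range ι) := by
    by_cases h : ∀ w ∈ c.support, w ∈ Set.range ι
    · exact ⟨a, c.start_mem_support, fun _ => h⟩
    · push Not at h
      obtain ⟨b, hb, hb'⟩ := h
      exact ⟨b, hb, fun h => absurd h hb'⟩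
  obtain ⟨b, hb, hb'⟩ := key
  have hc₀ : (c.rotate b hb).IsCycle := hc.rotate hb
  have he₀ : ∀ e, e ∈ (c.rotate b hb).edges ↔ e ∈ c.edges := fun e =>
    (c.rotate_edges b hb).perm.mem_iff
  have hs₀ : ∀ w, w ∈ (c.rotate b hb).support ↔ w ∈ c.support := by simp
  generalize c.rotate b hb = c₀ at hc₀ he₀ hs₀
  cases c₀ with
  | nil => simp at hc₀
  | cons h t =>
    rw [Walk.cons_isCycle_iff] at hc₀
    obtain ⟨μ, h1, h2, h3⟩ := hc₀.1.exists_matching hι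
    have hst : ∀ w, w ∈ c.support → w ∈ t.support := by
      intro w hw
      have := (hs₀ w).2 hw
      rw [Walk.support_cons, List.mem_cons] at this
      rcases this with rfl | h
      · exact t.end_mem_support
      · exact h
    have het : ∀ e, e ∈ t.edges → e ∈ c.edges := fun e he => (he₀ e).1 (by simp [he])
    refine ⟨μ, h1, fun p hp => het _ (h2 p hp), fun p hp hμ => ?_⟩
    rcases h3 p (hst _ hp) hμ with ⟨w, hw, hw'⟩ | h'
    · exact Or.inl ⟨w, hw, het _ hw'⟩
    · have hall := hb' ⟨p, h'⟩
      refine Or.inr ⟨hall, fun q hq hμq => ?_⟩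
      rcases h3 q (hst _ hq) hμq with ⟨w, hw, hw'⟩ | h''
      · exact absurd (hall w (c.fst_mem_support_of_mem_edges (het _ hw'))) hw
      · exact hι (h''.trans h'.symm)

end SimpleGraph

/-! ### Absorbing the rungs of a second layer into a cycle -/

/-- Two disjoint copies `ι` and `κ` of `X` in a graph, joined by the perfect matching
`ι p ↔ κ p`, where `X` carries a fixed-point-free involution `τ` exchanging the low elements with
the others, compatible with the edges of the graph. -/
structure DoubleLayer {V : Type*} (G : SimpleGraph V) (X : Type*) where
  ι : X → V
  κ : X → V
  τ : X → X
  Low : X → Prop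
  ι_injective : Function.Injective ι
  κ_injective : Function.Injective κ
  ι_ne_κ : ∀ p q, ι p ≠ κ q
  τ_τ : ∀ p, τ (τ p) = p
  low_τ : ∀ p, Low (τ p) ↔ ¬ Low p
  adj_ι_κ : ∀ p, G.Adj (ι p) (κ p)
  adj_ι_τ : ∀ p, G.Adj (ι p) (ι (τ p))
  adj_κ : ∀ p q, G.Adj (ι p) (ι q) → G.Adj (κ p) (κ q)
  adj_κ_τ : ∀ p q, G.Adj (ι p) (ι q) → q ≠ τ p → G.Adj (κ (τ p)) (κ (τ q))
  adj_outside : ∀ w p, w ∉ Set.range ι → w ∉ Set.range κ → Low p → G.Adj w (ι p) →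
    G.Adj w (κ (τ p))

namespace DoubleLayer

variable {V X : Type*} {G : SimpleGraph V}

/-- The pairing `μ` selects edges of the cycle `c` within the first layer, and the part `Z` of the
second layer has been absorbed by `c` in such a way that the rest of it can still be absorbed. -/
structure Absorbs (L : DoubleLayer G X) (μ : X → X) {a : V} (c : G.Walk a a) (Z : Finset X) :
    Prop where
  isCycle : c.IsCycle
  τ_mem : ∀ p ∈ Z, L.τ p ∈ Z
  fresh : ∀ p ∉ Z, L.κ p ∉ c.support
  paired : ∀ p ∉ Z, μ p ∉ Z → μ p ≠ p → s(L.ι p, L.ι (μ p)) ∈ c.edges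
  -- Needed only when `p` and `τ p` are both single, since otherwise the rung can be entered through
  -- a pair. Low elements suffice: one end of each rung is low, and `adj_outside` applies to it.
  unpaired : ∀ p ∉ Z, μ p = p → μ (L.τ p) = L.τ p → L.Low p →
    ∃ w, w ∉ Set.range L.ι ∧ w ∉ Set.range L.κ ∧ s(w, L.ι p) ∈ c.edges
  -- At most one end of a rung still awaits its partner, so using up the rung edge never blocks the
  -- other end.
  rung : ∀ r ∈ Z, μ r ∉ Z → s(L.κ r, L.κ (L.τ r)) ∈ c.edges ∧ μ (L.τ r) ∈ Z

variable {L : DoubleLayer G X} {μ : X → X} {a : V} {c : G.Walk a a} {Z : Finset X}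

theorem τ_ne (L : DoubleLayer G X) (p : X) : L.τ p ≠ p := by
  intro h
  have := L.low_τ p
  rw [h] at this
  tauto

theorem adj_κ_self (L : DoubleLayer G X) (p : X) : G.Adj (L.κ p) (L.κ (L.τ p)) :=
  L.adj_κ _ _ (L.adj_ι_τ p)

theorem ι_eq_iff (L : DoubleLayer G X) (p q : X) : L.ι p = L.ι q ↔ p = q := L.ι_injective.eq_iff

theorem κ_eq_iff (L : DoubleLayer G X) (p q : X) : L.κ p = L.κ q ↔ p = q := L.κ_injective.eq_iff

theorem τ_eq_iff (L : DoubleLayer G X) (p q : X) : L.τ p = q ↔ p = L.τ q :=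
  ⟨fun h => by rw [← h, L.τ_τ], fun h => by rw [h, L.τ_τ]⟩

theorem Absorbs.τ_mem_iff (h : L.Absorbs μ c Z) (p : X) : L.τ p ∈ Z ↔ p ∈ Z :=
  ⟨fun hp => by simpa [L.τ_τ] using h.τ_mem _ hp, h.τ_mem p⟩

variable [DecidableEq X]

/-- A rung whose upper end is paired with an unabsorbed element allows to absorb the rung there. -/
theorem Absorbs.extend (hμ : Function.Involutive μ) (hadj : ∀ p, μ p ≠ p → G.Adj (L.ι p) (L.ι (μ p)))
    (h : L.Absorbs μ c Z) {r : X} (hr : r ∈ Z) (hr' : μ r ∉ Z) :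
    ∃ (b : V) (d : G.Walk b b), d.length = c.length + 2 ∧
      L.Absorbs μ d (insert (μ r) (insert (L.τ (μ r)) Z)) := by
  obtain ⟨hrung, hτr⟩ := h.rung r hr hr'
  set s := μ r with hs
  have hμs : μ s = r := hμ r
  have hsr : s ≠ r := fun h' => hr' (h' ▸ hr)
  have hτs : L.τ s ∉ Z := by rwa [h.τ_mem_iff]
  have hsτr : s ≠ L.τ r := fun h' => hr' (h' ▸ h.τ_mem _ hr)
  have ha := hadj r hsr
  -- The rung edge is rerouted through `κ r`, `κ s`, `κ (τ s)`, `κ (τ r)`.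
  obtain ⟨b, d, hd, hl, hsup, he, -, he2, -⟩ := h.isCycle.exists_insert_pair hrung
    (h.fresh _ hr') (h.fresh _ hτs) (L.adj_κ _ _ ha) (L.adj_κ_self s)
    (L.adj_κ_τ _ _ ha hsτr).symm
  refine ⟨b, d, hl, hd, ?_, ?_, ?_, ?_, ?_⟩
  · simp only [Finset.mem_insert]
    rintro p (rfl | rfl | hp)
    · simp
    · simp [L.τ_τ]
    · exact Or.inr (Or.inr (h.τ_mem p hp))
  · simp only [Finset.mem_insert, not_or, hsup, L.κ_eq_iff]
    rintro p ⟨h1, h2, h3⟩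
    exact ⟨h.fresh p h3, h1, h2⟩
  · simp only [Finset.mem_insert, not_or]
    rintro p ⟨-, -, h3⟩ ⟨-, -, h4⟩ h5
    refine he _ (h.paired p h3 h4 h5) fun h' => ?_
    simp [L.ι_ne_κ] at h'
  · simp only [Finset.mem_insert, not_or]
    rintro p ⟨-, -, h3⟩ h4 h5 h6
    obtain ⟨w, h7, h8, h9⟩ := h.unpaired p h3 h4 h5 h6
    refine ⟨w, h7, h8, he _ h9 fun h' => ?_⟩
    simp [L.ι_ne_κ] at h'
  · simp only [Finset.mem_insert, not_or]
    rintro p (rfl | rfl | hp) ⟨h1, h2, h3⟩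
    · exact absurd (hμs ▸ hr) h3
    · rw [L.τ_τ, Sym2.eq_swap]
      exact ⟨he2, Or.inr (Or.inr (hμs ▸ hr))⟩
    · obtain ⟨h4, h5⟩ := h.rung p hp h3
      refine ⟨he _ h4 fun h' => ?_, Or.inr (Or.inr h5)⟩
      simp only [Sym2.eq_iff, L.κ_eq_iff] at h'
      rcases h' with ⟨rfl, -⟩ | ⟨rfl, -⟩
      · exact h1 rfl
      · exact h3 hτr

/-- An unpaired low element next to a vertex outside the two layers is absorbed with its partner. -/
theorem Absorbs.start_unpaired (h : L.Absorbs μ c Z) {p : X} (hp : p ∉ Z) (hμp : μ p = p)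
    (hlow : L.Low p) {w : V} (hwι : w ∉ Set.range L.ι) (hwκ : w ∉ Set.range L.κ)
    (hw : s(w, L.ι p) ∈ c.edges) :
    ∃ (b : V) (d : G.Walk b b), d.length = c.length + 2 ∧
      L.Absorbs μ d (insert p (insert (L.τ p) Z)) ∧ s(L.ι p, L.κ p) ∈ d.edges ∧
      ∀ v ∈ d.support, v ∈ c.support ∨ ∃ r ∉ Z, L.κ r = v := by
  have hτp : L.τ p ∉ Z := by rwa [h.τ_mem_iff]
  -- The detour is `w`, `κ (τ p)`, `κ p`, `ι p`: the outside vertex reaches the opposite end of the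
  -- rung.
  obtain ⟨b, d, hd, hl, hsup, he, -, he2, he3⟩ := h.isCycle.exists_insert_pair hw
    (h.fresh _ hτp) (h.fresh _ hp) (L.adj_outside w p hwι hwκ hlow (c.adj_of_mem_edges hw))
    (L.adj_κ_self p).symm (L.adj_ι_κ p).symm
  refine ⟨b, d, hl, ⟨hd, ?_, ?_, ?_, ?_, ?_⟩, by rwa [Sym2.eq_swap], ?_⟩
  · simp only [Finset.mem_insert]
    rintro q (rfl | rfl | hq)
    · simp
    · simp [L.τ_τ]
    · exact Or.inr (Or.inr (h.τ_mem q hq))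
  · simp only [Finset.mem_insert, not_or, hsup, L.κ_eq_iff]
    rintro q ⟨h1, h2, h3⟩
    exact ⟨h.fresh q h3, h2, h1⟩
  · simp only [Finset.mem_insert, not_or]
    rintro q ⟨h1, -, h3⟩ ⟨h2, -, h4⟩ h5
    refine he _ (h.paired q h3 h4 h5) fun h' => ?_
    simp [L.ι_eq_iff, h1, h2] at h'
  · simp only [Finset.mem_insert, not_or]
    rintro q ⟨h1, -, h3⟩ h4 h5 h6
    obtain ⟨w', h7, h8, h9⟩ := h.unpaired q h3 h4 h5 h6
    refine ⟨w', h7, h8, he _ h9 fun h' => ?_⟩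
    simp only [Sym2.eq_iff, L.ι_eq_iff, h1, and_false, false_or] at h'
    exact h7 ⟨p, h'.1.symm⟩
  · simp only [Finset.mem_insert, not_or]
    rintro q (rfl | rfl | hq) ⟨h1, h2, h3⟩
    · exact absurd hμp h1
    · rw [L.τ_τ]
      exact ⟨he2, Or.inl hμp⟩
    · obtain ⟨h4, h5⟩ := h.rung q hq h3
      refine ⟨he _ h4 fun h' => ?_, Or.inr (Or.inr h5)⟩
      simp only [Sym2.eq_iff] at h'
      rcases h' with ⟨h', -⟩ | ⟨h', -⟩
      · exact hwκ ⟨_, h'⟩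
      · exact L.ι_ne_κ _ _ h'.symm
  · intro v hv
    rcases (hsup v).1 hv with h' | rfl | rfl
    · exact Or.inl h'
    · exact Or.inr ⟨_, by assumption, rfl⟩
    · exact Or.inr ⟨_, by assumption, rfl⟩

/-- A pair of `μ` which agrees with a pair of `τ` is absorbed along its edge. -/
theorem Absorbs.start_vertical (hμ : Function.Involutive μ) (h : L.Absorbs μ c Z) {p : X}
    (hp : p ∉ Z) (hμp : μ p = L.τ p) :
    ∃ (b : V) (d : G.Walk b b), d.length = c.length + 2 ∧
      L.Absorbs μ d (insert p (insert (L.τ p) Z)) ∧ s(L.ι p, L.κ p) ∈ d.edges ∧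
      ∀ v ∈ d.support, v ∈ c.support ∨ ∃ r ∉ Z, L.κ r = v := by
  have hτp : L.τ p ∉ Z := by rwa [h.τ_mem_iff]
  have hμτp : μ (L.τ p) = p := by rw [← hμp, hμ]
  have hw := h.paired p hp (hμp ▸ hτp) (hμp ▸ L.τ_ne p)
  rw [hμp] at hw
  obtain ⟨b, d, hd, hl, hsup, he, he1, -, -⟩ := h.isCycle.exists_insert_pair hw
    (h.fresh _ hp) (h.fresh _ hτp) (L.adj_ι_κ p) (L.adj_κ_self p) (L.adj_ι_κ _).symm
  refine ⟨b, d, hl, ⟨hd, ?_, ?_, ?_, ?_, ?_⟩, he1, ?_⟩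
  · simp only [Finset.mem_insert]
    rintro q (rfl | rfl | hq)
    · simp
    · simp [L.τ_τ]
    · exact Or.inr (Or.inr (h.τ_mem q hq))
  · simp only [Finset.mem_insert, not_or, hsup, L.κ_eq_iff]
    rintro q ⟨h1, h2, h3⟩
    exact ⟨h.fresh q h3, h1, h2⟩
  · simp only [Finset.mem_insert, not_or]
    rintro q ⟨h1, h1', h3⟩ ⟨h2, -, h4⟩ h5
    refine he _ (h.paired q h3 h4 h5) fun h' => ?_
    simp [L.ι_eq_iff, h1, h1'] at h'
  · simp only [Finset.mem_insert, not_or]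
    rintro q ⟨h1, h1', h3⟩ h4 h5 h6
    obtain ⟨w', h7, h8, h9⟩ := h.unpaired q h3 h4 h5 h6
    refine ⟨w', h7, h8, he _ h9 fun h' => ?_⟩
    simp [L.ι_eq_iff, h1, h1'] at h'
  · simp only [Finset.mem_insert, not_or]
    rintro q (rfl | rfl | hq) ⟨h1, h2, h3⟩
    · exact absurd hμp h2
    · exact absurd hμτp h1
    · obtain ⟨h4, h5⟩ := h.rung q hq h3
      refine ⟨he _ h4 fun h' => ?_, Or.inr (Or.inr h5)⟩
      simp [(L.ι_ne_κ _ _).symm] at h'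
  · intro v hv
    rcases (hsup v).1 hv with h' | rfl | rfl
    · exact Or.inl h'
    · exact Or.inr ⟨_, by assumption, rfl⟩
    · exact Or.inr ⟨_, by assumption, rfl⟩

/-- The two rungs through the ends of a pair of `μ` are absorbed along its edge. -/
theorem Absorbs.start_horizontal (hμ : Function.Involutive μ) (h : L.Absorbs μ c Z) {p : X}
    (hp : p ∉ Z) (hμpZ : μ p ∉ Z) (hne : μ p ≠ p) (hμp : μ p ≠ L.τ p) :
    ∃ (b : V) (d : G.Walk b b) (b' : V) (d' : G.Walk b' b'), d'.IsCycle ∧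
      d'.length = c.length + 2 ∧ d.length = c.length + 4 ∧
      L.Absorbs μ d (insert p (insert (L.τ p) (insert (μ p) (insert (L.τ (μ p)) Z)))) ∧
      s(L.ι p, L.κ p) ∈ d.edges ∧ ∀ v ∈ d.support, v ∈ c.support ∨ ∃ r ∉ Z, L.κ r = v := by
  have hw := h.paired p hp hμpZ hne
  have ha := c.adj_of_mem_edges hw
  set q := μ p with hq
  have hμq : μ q = p := hμ p
  have hτp : L.τ p ∉ Z := by rwa [h.τ_mem_iff]
  have hτq : L.τ q ∉ Z := by rwa [h.τ_mem_iff]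
  have hpτq : p ≠ L.τ q := fun h' => hμp (by rw [h', L.τ_τ])
  -- First the detour `ι p`, `κ p`, `κ q`, `ι q`; then its middle edge is expanded to `κ p`, `κ (τ
  -- p)`, `κ (τ q)`, `κ q`. The intermediate cycle is kept to realise the length in between.
  obtain ⟨b', d', hd', hl', hsup', he', he1', he2', he3'⟩ := h.isCycle.exists_insert_pair hw
    (h.fresh _ hp) (h.fresh _ hμpZ) (L.adj_ι_κ p) (L.adj_κ _ _ ha) (L.adj_ι_κ q).symm
  have hfresh : ∀ r, r ∉ Z → r ≠ p → r ≠ q → L.κ r ∉ d'.support := by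
    intro r h1 h2 h3
    simp [hsup', L.κ_eq_iff, h.fresh r h1, h2, h3]
  obtain ⟨b, d, hd, hl, hsup, he, he1, he2, he3⟩ := hd'.exists_insert_pair he2'
    (hfresh _ hτp (L.τ_ne p) hμp.symm) (hfresh _ hτq hpτq.symm (L.τ_ne q))
    (L.adj_κ_self p) (L.adj_κ_τ _ _ ha hμp) (L.adj_κ_self q).symm
  refine ⟨b, d, b', d', hd', hl', by omega, ⟨hd, ?_, ?_, ?_, ?_, ?_⟩, ?_, ?_⟩
  · simp only [Finset.mem_insert]
    rintro r (rfl | rfl | rfl | rfl | hr)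
    · simp
    · simp [L.τ_τ]
    · simp
    · simp [L.τ_τ]
    · simp [h.τ_mem r hr]
  · simp only [Finset.mem_insert, not_or, hsup, hsup', L.κ_eq_iff]
    rintro r ⟨h1, h2, h3, h4, h5⟩
    exact ⟨⟨h.fresh r h5, h1, h3⟩, h2, h4⟩
  · simp only [Finset.mem_insert, not_or]
    rintro r ⟨h1, -, h3, -, h5⟩ ⟨-, -, -, -, h6⟩ h7
    refine he _ (he' _ (h.paired r h5 h6 h7) fun h' => ?_) fun h' => ?_
    · simp [L.ι_eq_iff, h1, h3] at h'
    · simp [L.ι_ne_κ] at h'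
  · simp only [Finset.mem_insert, not_or]
    rintro r ⟨h1, -, h3, -, h5⟩ h6 h7 h8
    obtain ⟨w', h9, h10, h11⟩ := h.unpaired r h5 h6 h7 h8
    refine ⟨w', h9, h10, he _ (he' _ h11 fun h' => ?_) fun h' => ?_⟩
    · simp [L.ι_eq_iff, h1, h3] at h'
    · simp [L.ι_ne_κ] at h'
  · simp only [Finset.mem_insert, not_or]
    rintro r (rfl | rfl | rfl | rfl | hr) ⟨h1, h2, h3, h4, h5⟩
    · exact absurd rfl h3
    · rw [L.τ_τ, Sym2.eq_swap]
      exact ⟨he1, Or.inr (Or.inr (Or.inl rfl))⟩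
    · exact absurd hμq h1
    · rw [L.τ_τ]
      exact ⟨he3, Or.inl hμq⟩
    · obtain ⟨h6, h7⟩ := h.rung r hr h5
      refine ⟨he _ (he' _ h6 fun h' => ?_) fun h' => ?_, by simp [h7]⟩
      · simp [(L.ι_ne_κ _ _).symm] at h'
      · simp only [Sym2.eq_iff, L.κ_eq_iff] at h'
        rcases h' with ⟨rfl, -⟩ | ⟨rfl, -⟩
        · exact hp hr
        · exact hμpZ hr
  · refine he _ he1' fun h' => ?_
    simp [L.ι_ne_κ] at h'
  · intro v hv
    rcases (hsup v).1 hv with h' | rfl | rfl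
    · rcases (hsup' v).1 h' with h' | rfl | rfl
      · exact Or.inl h'
      · exact Or.inr ⟨_, by assumption, rfl⟩
      · exact Or.inr ⟨_, by assumption, rfl⟩
    · exact Or.inr ⟨_, by assumption, rfl⟩
    · exact Or.inr ⟨_, by assumption, rfl⟩

end DoubleLayer

/-! ### Iterating the absorption -/

namespace DoubleLayer

variable {V X : Type*} {G : SimpleGraph V}
variable {L : DoubleLayer G X} {μ : X → X} {a : V} {c : G.Walk a a} {Z : Finset X}
variable [DecidableEq X] [Fintype X]

theorem Absorbs.card_compl_insert (h : L.Absorbs μ c Z) {p : X} (hp : p ∉ Z) :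
    Zᶜ.card = (insert p (insert (L.τ p) Z))ᶜ.card + 2 := by
  have hτp : L.τ p ∉ Z := by rwa [h.τ_mem_iff]
  have h1 : p ∉ insert (L.τ p) Z := by simp [hp, (L.τ_ne p).symm]
  have h2 := Finset.card_insert_of_notMem h1
  rw [Finset.card_insert_of_notMem hτp] at h2
  have h3 := Finset.card_le_univ (insert p (insert (L.τ p) Z))
  rw [Finset.card_compl, Finset.card_compl]
  omega

/-- The three ways to start are merged: `k` rungs are absorbed, and the cycles for `j < k` fill the
skipped lengths. The edge `ι q`, `κ q` is kept for inserting a missed vertex later. -/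
theorem Absorbs.start (hμ : Function.Involutive μ) (h : L.Absorbs μ c Z) {q : X} (hq : q ∉ Z)
    (hμqZ : μ q ∉ Z) (hgood : μ q = q → L.Low q ∧
      ∃ w, w ∉ Set.range L.ι ∧ w ∉ Set.range L.κ ∧ s(w, L.ι q) ∈ c.edges) :
    ∃ (b : V) (d : G.Walk b b) (Z' : Finset X) (k : ℕ), d.length = c.length + 2 * k ∧
      Zᶜ.card = Z'ᶜ.card + 2 * k ∧ (1 ≤ k ∧ ∀ j < k, ∃ (b' : V) (d' : G.Walk b' b'), d'.IsCycle ∧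
      d'.length = c.length + 2 * j) ∧ Z ⊆ Z' ∧ L.Absorbs μ d Z' ∧ s(L.ι q, L.κ q) ∈ d.edges ∧
      ∀ v ∈ d.support, v ∈ c.support ∨ ∃ r ∉ Z, L.κ r = v := by
  have one : ∀ j < 1, ∃ (b' : V) (d' : G.Walk b' b'), d'.IsCycle ∧
      d'.length = c.length + 2 * j := by
    intro j hj
    obtain rfl : j = 0 := by omega
    exact ⟨a, c, h.isCycle, by simp⟩
  have sub : ∀ r s : X, ∀ W : Finset X, W ⊆ insert r (insert s W) := fun r s W y hy => by simp [hy]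
  by_cases hfix : μ q = q
  · obtain ⟨hlow, w, h1, h2, h3⟩ := hgood hfix
    obtain ⟨b, d, hl, hA, he, hs⟩ := h.start_unpaired hq hfix hlow h1 h2 h3
    exact ⟨b, d, _, 1, hl, h.card_compl_insert hq, ⟨le_rfl, one⟩, sub _ _ _, hA, he, hs⟩
  by_cases hvert : μ q = L.τ q
  · obtain ⟨b, d, hl, hA, he, hs⟩ := h.start_vertical hμ hq hvert
    exact ⟨b, d, _, 1, hl, h.card_compl_insert hq, ⟨le_rfl, one⟩, sub _ _ _, hA, he, hs⟩
  · obtain ⟨b, d, b', d', hd', hl', hl, hA, he, hs⟩ := h.start_horizontal hμ hq hμqZ hfix hvert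
    refine ⟨b, d, _, 2, hl, ?_, ⟨by omega, fun j hj => ?_⟩, (sub _ _ _).trans (sub _ _ _), hA, he,
      hs⟩
    · have hτq : L.τ q ∉ Z := by rwa [h.τ_mem_iff]
      have hτμq : L.τ (μ q) ∉ Z := by rwa [h.τ_mem_iff]
      have h1 : L.τ (μ q) ≠ q := fun h' => hvert ((L.τ_eq_iff _ _).1 h')
      have h2 : L.τ (μ q) ≠ L.τ q := fun h' => hfix (by simpa [L.τ_τ] using congrArg L.τ h')
      have h3 := Finset.card_le_univ (insert q (insert (L.τ q) (insert (μ q)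
        (insert (L.τ (μ q)) Z))))
      have h4 : (insert q (insert (L.τ q) (insert (μ q)
          (insert (L.τ (μ q)) Z)))).card = Z.card + 4 := by
        rw [Finset.card_insert_of_notMem, Finset.card_insert_of_notMem,
          Finset.card_insert_of_notMem, Finset.card_insert_of_notMem hτμq]
        · simp [hμqZ, (L.τ_ne _).symm]
        · simp [hτq, Ne.symm hvert, h2.symm]
        · simp [hq, (L.τ_ne _).symm, h1.symm, Ne.symm hfix]
      rw [Finset.card_compl, Finset.card_compl]
      omega
    · rcases (by omega : j = 0 ∨ j = 1) with rfl | rfl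
      · exact one 0 (by omega)
      · exact ⟨b', d', hd', hl'⟩

/-- Induction on the unabsorbed part. If no absorbed element has an unabsorbed partner, the
complement of `Z` is closed under `μ`; it contains either a pair or a rung with both ends single,
and one can start there. -/
theorem Absorbs.exists_isCycle (hμ : Function.Involutive μ)
    (hadj : ∀ p, μ p ≠ p → G.Adj (L.ι p) (L.ι (μ p))) (h : L.Absorbs μ c Z) {j : ℕ}
    (hj : 2 * j ≤ Zᶜ.card) :
    ∃ (b : V) (d : G.Walk b b), d.IsCycle ∧ d.length = c.length + 2 * j := by
  induction hn : Zᶜ.card using Nat.strong_induction_on generalizing a c Z j with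
  | _ n ih =>
  rcases Nat.eq_zero_or_pos j with rfl | hj0
  · exact ⟨a, c, h.isCycle, by simp⟩
  by_cases hact : ∃ r ∈ Z, μ r ∉ Z
  · obtain ⟨r, hr, hr'⟩ := hact
    obtain ⟨b, d, hl, hA⟩ := h.extend hμ hadj hr hr'
    have hcard := h.card_compl_insert hr'
    obtain ⟨b', d', hd', hl'⟩ := ih _ (by omega) hA (j := j - 1) (by omega) rfl
    exact ⟨b', d', hd', by omega⟩
  push Not at hact
  have hμZ : ∀ p ∉ Z, μ p ∉ Z := fun p hp h' => hp (by simpa [hμ p] using hact _ h')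
  have hq : ∃ q ∉ Z, μ q = q → L.Low q ∧
      ∃ w, w ∉ Set.range L.ι ∧ w ∉ Set.range L.κ ∧ s(w, L.ι q) ∈ c.edges := by
    by_cases hall : ∀ p ∉ Z, μ p = p
    · obtain ⟨p, hp⟩ : Zᶜ.Nonempty := Finset.card_pos.1 (by omega)
      rw [Finset.mem_compl] at hp
      have hτp : L.τ p ∉ Z := by rwa [h.τ_mem_iff]
      by_cases hlow : L.Low p
      · exact ⟨p, hp, fun _ => ⟨hlow, h.unpaired p hp (hall p hp) (hall _ hτp) hlow⟩⟩
      · have hlow' := (L.low_τ p).2 hlow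
        exact ⟨L.τ p, hτp, fun _ => ⟨hlow', h.unpaired _ hτp (hall _ hτp)
          (hall _ (by rwa [L.τ_τ])) hlow'⟩⟩
    · push Not at hall
      obtain ⟨p, hp, hne⟩ := hall
      exact ⟨p, hp, fun h' => absurd h' hne⟩
  obtain ⟨q, hq, hgood⟩ := hq
  obtain ⟨b, d, Z', k, hl, hcard, ⟨hk, hsmall⟩, -, hA, -, -⟩ := h.start hμ hq (hμZ q hq) hgood
  by_cases hjk : j < k
  · exact hsmall j hjk
  · obtain ⟨b', d', hd', hl'⟩ := ih _ (by omega) hA (j := j - k) (by omega) rfl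
    exact ⟨b', d', hd', by omega⟩

/-- A cycle which avoids the second layer and misses at most one other vertex can be lengthened by
any even number up to the size of the second layer. -/
theorem exists_isCycle (L : DoubleLayer G X) (hc : c.IsCycle) (hκ : ∀ p, L.κ p ∉ c.support)
    (hmiss : ∀ v v', v ∉ Set.range L.κ → v' ∉ Set.range L.κ → v ∉ c.support → v' ∉ c.support →
      v = v')
    (hb : ∃ b, b ∉ Set.range L.ι ∧ b ∉ Set.range L.κ)
    (hnbr : ∀ y, L.ι y ∉ c.support → L.Low y → ∃ q, q ≠ y ∧ L.Low q ∧ G.Adj (L.ι y) (L.ι q))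
    {j : ℕ} (hj : 2 * j ≤ Fintype.card X) :
    ∃ (b : V) (d : G.Walk b b), d.IsCycle ∧ d.length = c.length + 2 * j := by
  obtain ⟨μ, hμ, hedge, hfix⟩ := hc.exists_matching L.ι_injective
  obtain ⟨b, hbι, hbκ⟩ := hb
  have hικ : ∀ p, L.ι p ∉ Set.range L.κ := fun p ⟨q, hq⟩ => L.ι_ne_κ p q hq.symm
  have hadj : ∀ p, μ p ≠ p → G.Adj (L.ι p) (L.ι (μ p)) := fun p hp => c.adj_of_mem_edges (hedge p hp)
  have hgood : ∀ p, L.ι p ∈ c.support → μ p = p →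
      (∃ w, w ∉ Set.range L.ι ∧ w ∉ Set.range L.κ ∧ s(w, L.ι p) ∈ c.edges) ∨
      b ∉ c.support ∧ ∀ q, L.ι q ∈ c.support → μ q = q → q = p := by
    intro p hp hμp
    rcases hfix p hp hμp with ⟨w, hw, hw'⟩ | ⟨hall, huniq⟩
    · refine Or.inl ⟨w, hw, ?_, hw'⟩
      rintro ⟨r, rfl⟩
      exact hκ r (c.fst_mem_support_of_mem_edges hw')
    · exact Or.inr ⟨fun h' => hbι (hall b h'), huniq⟩
  have hunp : ∀ p, L.ι p ∈ c.support → μ p = p → μ (L.τ p) = L.τ p →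
      ∃ w, w ∉ Set.range L.ι ∧ w ∉ Set.range L.κ ∧ s(w, L.ι p) ∈ c.edges := by
    intro p hp h1 h2
    -- In the second case `b` and `ι (τ p)` would both be missed, by uniqueness of the single
    -- element.
    rcases hgood p hp h1 with h' | ⟨hbc, huniq⟩
    · exact h'
    · by_cases hτ : L.ι (L.τ p) ∈ c.support
      · exact absurd (huniq _ hτ h2) (L.τ_ne p)
      · exact absurd ⟨_, (hmiss _ _ hbκ (hικ _) hbc hτ).symm⟩ hbι
  have hμmiss : ∀ p, L.ι p ∉ c.support → μ p = p := fun p hp => by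
    by_contra h'
    exact hp (c.fst_mem_support_of_mem_edges (hedge p h'))
  by_cases hy : ∃ y, L.ι y ∉ c.support ∧ L.Low y ∧ μ (L.τ y) = L.τ y
  · obtain ⟨y, hyc, hylow, hμτy⟩ := hy
    have hμy := hμmiss y hyc
    -- The rung of the missed `y` cannot be entered, so it is set aside as if absorbed. This is
    -- consistent because both its ends are single.
    have hA : L.Absorbs μ c {y, L.τ y} := by
      refine ⟨hc, ?_, fun p _ => hκ p, fun p _ _ hp => hedge p hp, ?_, ?_⟩
      · simp only [Finset.mem_insert, Finset.mem_singleton]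
        rintro p (rfl | rfl)
        · simp
        · simp [L.τ_τ]
      · simp only [Finset.mem_insert, Finset.mem_singleton, not_or]
        rintro p ⟨hpy, -⟩ h1 h2 -
        refine hunp p ?_ h1 h2
        by_contra hp
        exact hpy (L.ι_injective (hmiss _ _ (hικ _) (hικ _) hp hyc))
      · simp only [Finset.mem_insert, Finset.mem_singleton]
        rintro p (rfl | rfl) h'
        · simp [hμy] at h'
        · simp [hμτy] at h'
    have hcard : ({y, L.τ y} : Finset X)ᶜ.card + 2 = Fintype.card X := by
      have h1 := Finset.card_le_univ ({y, L.τ y} : Finset X)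
      rw [Finset.card_compl]
      rw [Finset.card_pair (L.τ_ne y).symm] at h1 ⊢
      omega
    by_cases hj' : 2 * j ≤ ({y, L.τ y} : Finset X)ᶜ.card
    · exact hA.exists_isCycle hμ hadj hj'
    -- For the remaining length two more vertices are needed. They are `ι y` and `κ y`, inserted
    -- between `ι q` and `κ q` after starting at a low neighbour `q` of `y`; only `κ (τ y)` is never
    -- used.
    obtain ⟨q, hqy, hqlow, hyq⟩ := hnbr y hyc hylow
    have hqc : L.ι q ∈ c.support := by
      by_contra hq
      exact hqy (L.ι_injective (hmiss _ _ (hικ _) (hικ _) hq hyc))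
    have hqτ : q ≠ L.τ y := fun h' => ((L.low_τ y).1 (h' ▸ hqlow)) hylow
    have hμq : ∀ r, μ r = r → q ≠ r → μ q ≠ r := fun r hr hqr h' =>
      hqr (by rw [← hμ q, h', hr])
    obtain ⟨b₁, d₁, Z', k, hl₁, hcard₁, ⟨hk, -⟩, hsub, hA₁, he₁, hs₁⟩ :=
      hA.start hμ (q := q) (by simp [hqy, hqτ]) (by simp [hμq _ hμy hqy, hμq _ hμτy hqτ])
        (fun h' => ⟨hqlow, by
          rcases hgood q hqc h' with h'' | ⟨hbc, -⟩
          · exact h''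
          · exact absurd ⟨_, (hmiss _ _ hbκ (hικ _) hbc hyc).symm⟩ hbι⟩)
    have hyZ : y ∈ Z' := hsub (by simp)
    have hyd : L.ι y ∉ d₁.support := fun h' => (hs₁ _ h').elim hyc fun ⟨r, _, hr⟩ => hικ y ⟨r, hr⟩
    have hκyd : L.κ y ∉ d₁.support := fun h' => by
      rcases hs₁ _ h' with h'' | ⟨r, hr, hr'⟩
      · exact hκ y h''
      · exact hr (by simp [L.κ_injective hr'])
    obtain ⟨b₂, d₂, hd₂, hl₂, hs₂, he₂, -, -, -⟩ := hA₁.isCycle.exists_insert_pair he₁ hyd hκyd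
      hyq.symm (L.adj_ι_κ y) (L.adj_κ _ _ hyq)
    have hA₂ : L.Absorbs μ d₂ Z' := by
      refine ⟨hd₂, hA₁.τ_mem, fun p hp h' => ?_, fun p h1 h2 h3 => ?_, fun p h1 h2 h3 h4 => ?_,
        fun r h1 h2 => ?_⟩
      · rcases (hs₂ _).1 h' with h'' | h'' | h''
        · exact hA₁.fresh p hp h''
        · exact L.ι_ne_κ _ _ h''.symm
        · exact hp (L.κ_injective h'' ▸ hyZ)
      · refine he₂ _ (hA₁.paired p h1 h2 h3) fun h' => ?_
        simp [L.ι_ne_κ] at h'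
      · obtain ⟨w, h5, h6, h7⟩ := hA₁.unpaired p h1 h2 h3 h4
        refine ⟨w, h5, h6, he₂ _ h7 fun h' => ?_⟩
        simp only [Sym2.eq_iff] at h'
        rcases h' with ⟨-, h'⟩ | ⟨h', -⟩
        · exact L.ι_ne_κ _ _ h'
        · exact h6 ⟨_, h'.symm⟩
      · obtain ⟨h3, h4⟩ := hA₁.rung r h1 h2
        refine ⟨he₂ _ h3 fun h' => ?_, h4⟩
        simp [(L.ι_ne_κ _ _).symm] at h'
    obtain ⟨b₃, d₃, hd₃, hl₃⟩ := hA₂.exists_isCycle hμ hadj (j := j - k - 1) (by omega)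
    exact ⟨b₃, d₃, hd₃, by omega⟩
  · push Not at hy
    have hA : L.Absorbs μ c ∅ := by
      refine ⟨hc, by simp, fun p _ => hκ p, fun p _ _ hp => hedge p hp, fun p _ h1 h2 h3 => ?_,
        by simp⟩
      exact hunp p (by_contra fun hp => hy p hp h3 h2) h1 h2
    exact hA.exists_isCycle hμ hadj (by simpa using hj)

end DoubleLayer

/-! ### Dominating sets of a graph with twin leaves -/

theorem tarsGraph_adj_iff {V : Type*} {G : SimpleGraph V} {C D : {D : Set V // IsDominatingSet G D}} :
    (tarsGraph G).Adj C D ↔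
      (∃ w, (w ∈ C.1 ↔ w ∉ D.1) ∧ ∀ z, z ≠ w → (z ∈ C.1 ↔ z ∈ D.1)) ∨
      ∃ a b, a ∈ C.1 ∧ a ∉ D.1 ∧ b ∉ C.1 ∧ b ∈ D.1 ∧ G.Adj a b ∧
        ∀ z, z ≠ a → z ≠ b → (z ∈ C.1 ↔ z ∈ D.1) := by
  refine or_congr ⟨?_, ?_⟩ ⟨?_, ?_⟩
  · rintro (⟨w, hw, h⟩ | ⟨w, hw, h⟩) <;> refine ⟨w, ?_, fun z hz => ?_⟩ <;> simp_all
  · rintro ⟨w, hw, h⟩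
    by_cases hC : w ∈ C.1
    · refine Or.inr ⟨w, hC, Set.ext fun z => ?_⟩
      by_cases hz : z = w
      · subst hz; simp [hw.1 hC]
      · simp [hz, h z hz]
    · refine Or.inl ⟨w, hC, Set.ext fun z => ?_⟩
      by_cases hz : z = w
      · subst hz; simp; tauto
      · simp [hz, h z hz]
  · rintro ⟨a, b, ha, ⟨hb, hb'⟩, hab, h⟩
    refine ⟨a, b, ha, by simp [h], hb', hb, hab, fun z h1 h2 => by simp [h, h1, h2]⟩
  · rintro ⟨a, b, ha, ha', hb, hb', hab, h⟩
    refine ⟨a, b, ha, ⟨hb', hb⟩, hab, Set.ext fun z => ?_⟩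
    by_cases h1 : z = a
    · subst h1; simp [ha']
    · by_cases h2 : z = b
      · subst h2; simp [hb', h1]
      · simp [h1, h2, h z h1 h2]

section TwinLeaves

variable {V : Type*} {H : SimpleGraph V} {u v x : V}

/-- Once `x` is present the leaves are irrelevant: they are dominated by `x`, and they dominate
nothing else but `x` and themselves. -/
theorem IsDominatingSet.of_leaves (hu : ∀ w, H.Adj u w ↔ w = x) (hv : ∀ w, H.Adj v w ↔ w = x)
    {C D : Set V} (hC : IsDominatingSet H C) (hx : x ∈ D)
    (h : ∀ w ∈ C, w ≠ u → w ≠ v → w ∈ D) : IsDominatingSet H D := by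
  intro w hw
  by_cases hwu : w = u
  · exact ⟨x, hx, hwu ▸ (hu x).2 rfl⟩
  by_cases hwv : w = v
  · exact ⟨x, hx, hwv ▸ (hv x).2 rfl⟩
  obtain ⟨d, hd, hwd⟩ := hC w fun h' => hw (h w h' hwu hwv)
  refine ⟨d, h d hd ?_ ?_, hwd⟩
  · rintro rfl
    exact hw ((hu w).1 hwd.symm ▸ hx)
  · rintro rfl
    exact hw ((hv w).1 hwd.symm ▸ hx)

theorem IsDominatingSet.leaf_mem (hu : ∀ w, H.Adj u w ↔ w = x) {D : Set V}
    (hD : IsDominatingSet H D) (hx : x ∉ D) : u ∈ D := by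
  by_contra h
  obtain ⟨d, hd, hud⟩ := hD u h
  exact hx ((hu d).1 hud ▸ hd)

/-- The dominating sets containing `v` and `x`. -/
abbrev CenteredDominatingSet (H : SimpleGraph V) (v x : V) : Type _ :=
  {D : Set V // IsDominatingSet H D ∧ v ∈ D ∧ x ∈ D}

/-- The dominating sets containing a vertex `x` with twin leaves `u` and `v`, with and without
`v`, and the toggling of `u`. -/
def twinLeavesDoubleLayer (huv : u ≠ v) (hu : ∀ w, H.Adj u w ↔ w = x)
    (hv : ∀ w, H.Adj v w ↔ w = x) :
    DoubleLayer (tarsGraph H) (CenteredDominatingSet H v x) :=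
  have hux : u ≠ x := ((hu x).2 rfl).ne
  have hvx : v ≠ x := ((hv x).2 rfl).ne
  { ι := fun p => ⟨p.1, p.2.1⟩
    κ := fun p => ⟨p.1 \ {v}, p.2.1.of_leaves hu hv ⟨p.2.2.2, hvx.symm⟩
      fun w hw _ h => ⟨hw, h⟩⟩
    τ := fun p => ⟨symmDiff p.1 {u}, p.2.1.of_leaves hu hv
        (by simp [Set.mem_symmDiff, p.2.2.2, hux.symm])
        (fun w hw h _ => by simp [Set.mem_symmDiff, hw, h]),
      by simp [Set.mem_symmDiff, p.2.2.1, huv.symm],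
      by simp [Set.mem_symmDiff, p.2.2.2, hux.symm]⟩
    Low := fun p => u ∉ p.1
    ι_injective := fun p q h => by
      exact Subtype.ext (Subtype.mk.inj h)
    κ_injective := fun p q h => by
      have h' : p.1 \ {v} = q.1 \ {v} := congrArg Subtype.val h
      refine Subtype.ext (Set.ext fun z => ?_)
      by_cases hz : z = v
      · subst hz; simp [p.2.2.1, q.2.2.1]
      · simpa [hz] using Set.ext_iff.1 h' z
    ι_ne_κ := fun p q h => by
      have h' : p.1 = q.1 \ {v} := congrArg Subtype.val h
      have := p.2.2.1
      simp [h'] at this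
    τ_τ := fun p => Subtype.ext (by simp)
    low_τ := fun p => by simp [Set.mem_symmDiff]
    adj_ι_κ := fun p => tarsGraph_adj_iff.2 <| Or.inl
      ⟨v, by simp [p.2.2.1], fun z hz => by simp [hz]⟩
    adj_ι_τ := fun p => tarsGraph_adj_iff.2 <| Or.inl
      ⟨u, by simp [Set.mem_symmDiff], fun z hz => by simp [hz, Set.mem_symmDiff]⟩
    adj_κ := fun p q h => by
      rw [tarsGraph_adj_iff] at h ⊢
      have hp := p.2.2.1
      have hq := q.2.2.1
      rcases h with ⟨w, hw, h⟩ | ⟨a, b, h1, h2, h3, h4, h5, h6⟩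
      · refine Or.inl ⟨w, ?_, fun z hz => ?_⟩
        · have hwv : w ≠ v := by rintro rfl; simp_all
          simpa [hwv] using hw
        · simp [h z hz]
      · have hav : a ≠ v := by rintro rfl; exact h2 hq
        have hbv : b ≠ v := by rintro rfl; exact h3 hp
        refine Or.inr ⟨a, b, ⟨h1, hav⟩, fun h => h2 h.1, fun h => h3 h.1, ⟨h4, hbv⟩, h5,
          fun z hz hz' => ?_⟩
        simp [h6 z hz hz']
    adj_κ_τ := fun p q h hne => by
      rw [tarsGraph_adj_iff] at h ⊢
      have hp := p.2.2
      have hq := q.2.2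
      rcases h with ⟨w, hw, h⟩ | ⟨a, b, h1, h2, h3, h4, h5, h6⟩
      · refine Or.inl ⟨w, ?_, fun z hz => ?_⟩
        · have hwv : w ≠ v := by rintro rfl; simp_all
          have hwu : w ≠ u := by
            rintro rfl
            refine hne (Subtype.ext (Set.ext fun z => ?_))
            by_cases hz : z = w
            · subst hz; simp [Set.mem_symmDiff] at hw ⊢; tauto
            · simpa [Set.mem_symmDiff, hz] using (h z hz).symm
          simpa [hwv, hwu, Set.mem_symmDiff] using hw
        · have := h z hz
          simp only [Set.mem_sdiff, Set.mem_symmDiff] at this ⊢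
          tauto
      · have hav : a ≠ v := by rintro rfl; exact h2 hq.1
        have hbv : b ≠ v := by rintro rfl; exact h3 hp.1
        -- A slide at `u` would involve `x`, which belongs to both sets.
        have hau : a ≠ u := by
          rintro rfl
          exact h3 ((hu b).1 h5 ▸ hp.2)
        have hbu : b ≠ u := by
          rintro rfl
          exact h2 ((hu a).1 h5.symm ▸ hq.2)
        refine Or.inr ⟨a, b, ?_, ?_, ?_, ?_, h5, fun z hz hz' => ?_⟩
        · simp [Set.mem_symmDiff, h1, hav, hau]
        · simp [Set.mem_symmDiff, h2, hau]
        · simp [Set.mem_symmDiff, h3, hbu]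
        · simp [Set.mem_symmDiff, h4, hbv, hbu]
        · have := h6 z hz hz'
          simp only [Set.mem_sdiff, Set.mem_symmDiff] at this ⊢
          tauto
    -- A set in neither layer lacks `x`, hence contains both leaves. The only move to a low set
    -- slides `u` to `x`; sliding `v` to `x` instead gives `κ (τ p)`.
    adj_outside := fun w p hι hκ hlow h => by
      have hxw : x ∉ w.1 := by
        intro hxw
        by_cases hvw : v ∈ w.1
        · exact hι ⟨⟨w.1, w.2, hvw, hxw⟩, rfl⟩
        · refine hκ ⟨⟨insert v w.1, w.2.of_leaves hu hv (by simp [hxw])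
            (fun z hz _ _ => by simp [hz]), by simp, by simp [hxw]⟩, Subtype.ext ?_⟩
          simp [hvw]
      have huw := w.2.leaf_mem hu hxw
      have hvw := w.2.leaf_mem hv hxw
      have hp := p.2.2
      rw [tarsGraph_adj_iff] at h ⊢
      rcases h with ⟨y, hy, h⟩ | ⟨a, b, h1, h2, h3, h4, h5, h6⟩
      · exfalso
        have e1 : u = y := by_contra fun e => hlow ((h u e).1 huw)
        have e2 : x = y := by_contra fun e => hxw ((h x e).2 hp.2)
        exact hux (e1.trans e2.symm)
      · have hbx : x = b := by
          by_contra e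
          by_cases e' : x = a
          · exact hxw (e' ▸ h1)
          · exact hxw ((h6 x e' e).2 hp.2)
        have hau : u = a := by
          by_contra e
          by_cases e' : u = b
          · exact h3 (e' ▸ huw)
          · exact hlow ((h6 u e e').1 huw)
        subst hbx hau
        refine Or.inr ⟨v, x, hvw, by simp, hxw, ?_, (hv x).2 rfl, fun z hz hz' => ?_⟩
        · simp [Set.mem_symmDiff, hp.2, hux.symm, hvx.symm]
        · by_cases hzu : z = u
          · subst hzu
            simpa [Set.mem_symmDiff, huw, huv] using hlow
          · simp [Set.mem_symmDiff, hzu, hz, h6 z hzu hz'] }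

end TwinLeaves

theorem SimpleGraph.Walk.IsCycle.card_add_length_le {V : Type*} [Finite V] {G : SimpleGraph V}
    {a : V} {c : G.Walk a a} (hc : c.IsCycle) (s : Finset V) (hs : ∀ y ∈ s, y ∉ c.support) :
    s.card + c.length ≤ Nat.card V := by
  classical
  have := Fintype.ofFinite V
  have h1 : c.support.tail.toFinset.card = c.length := by
    rw [List.toFinset_card_of_nodup hc.support_nodup]
    simp
  rw [← h1, ← Finset.card_union_of_disjoint, Nat.card_eq_fintype_card]
  · exact Finset.card_le_univ _
  · exact Finset.disjoint_left.2 fun y hy h => hs y hy (List.mem_of_mem_tail (List.mem_toFinset.1 h))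

theorem DoubleLayer.exists_isCycle_length_four {V X : Type*} {G : SimpleGraph V}
    (L : DoubleLayer G X) (p : X) :
    ∃ (a : V) (c : G.Walk a a), c.IsCycle ∧ c.length = 4 := by
  refine ⟨L.ι p, .cons (L.adj_ι_τ p) (.cons (L.adj_ι_κ _) (.cons (L.adj_κ_self p).symm
    (.cons (L.adj_ι_κ p).symm .nil))), ?_, rfl⟩
  rw [Walk.cons_isCycle_iff]
  have h1 := L.τ_ne p
  have h2 := L.ι_ne_κ
  have h3 := fun p q => (L.ι_ne_κ p q).symm
  simp [h1, h1.symm, h2, h3, L.ι_eq_iff, L.κ_eq_iff]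

theorem DoubleLayer.even_card {V X : Type*} [Fintype X] {G : SimpleGraph V}
    (L : DoubleLayer G X) : Even (Fintype.card X) := by
  classical
  have h := Equiv.Perm.two_dvd_card_support (σ := Function.Involutive.toPerm L.τ L.τ_τ)
    (Equiv.ext L.τ_τ)
  have huniv : (Function.Involutive.toPerm L.τ L.τ_τ).support = Finset.univ :=
    Finset.eq_univ_of_forall fun p => Equiv.Perm.mem_support.2 (L.τ_ne p)
  rw [huniv] at h
  exact even_iff_two_dvd.2 h

section TwinLeaves

variable {V : Type*} {H : SimpleGraph V} {u v x : V}

/-- One step from `y` towards `z`: deleting a vertex of `y` outside `z` when `z ⊆ y`, otherwise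
adding a vertex of `z`. -/
theorem exists_low_adj (hu : ∀ w, H.Adj u w ↔ w = x) (hv : ∀ w, H.Adj v w ↔ w = x)
    {y z : CenteredDominatingSet H v x} (hyz : z ≠ y) (hy : u ∉ y.1)
    (hz : u ∉ z.1) :
    ∃ q : CenteredDominatingSet H v x, q ≠ y ∧ u ∉ q.1 ∧
      (tarsGraph H).Adj ⟨y.1, y.2.1⟩ ⟨q.1, q.2.1⟩ := by
  by_cases hsub : z.1 ⊆ y.1
  · obtain ⟨w, hw, hwz⟩ : ∃ w ∈ y.1, w ∉ z.1 := by
      by_contra! h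
      exact hyz (Subtype.ext (Set.Subset.antisymm hsub h))
    have hne : ∀ d ∈ z.1, d ∈ y.1 \ {w} := fun d hd => ⟨hsub hd, fun h => hwz (h ▸ hd)⟩
    refine ⟨⟨y.1 \ {w}, z.2.1.of_leaves hu hv (hne _ z.2.2.2) fun d hd _ _ => hne d hd,
      hne _ z.2.2.1, hne _ z.2.2.2⟩, ?_, fun h => hy h.1, tarsGraph_adj_iff.2 (Or.inl ⟨w, ?_, ?_⟩)⟩
    · intro h
      have h' : y.1 \ {w} = y.1 := congrArg Subtype.val h
      rw [← h'] at hw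
      exact hw.2 rfl
    · simp [hw]
    · intro d hd
      simp [hd]
  · obtain ⟨w, hwz, hw⟩ := Set.not_subset.1 hsub
    have hwu : u ≠ w := fun h => hz (h ▸ hwz)
    refine ⟨⟨insert w y.1, y.2.1.of_leaves hu hv (Or.inr y.2.2.2) fun d hd _ _ => Or.inr hd,
      Or.inr y.2.2.1, Or.inr y.2.2.2⟩, ?_, by simp [hwu, hy],
      tarsGraph_adj_iff.2 (Or.inl ⟨w, ?_, ?_⟩)⟩
    · intro h
      have h' : insert w y.1 = y.1 := congrArg Subtype.val h
      exact hw (h' ▸ Set.mem_insert w y.1)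
    · simp [hw]
    · intro d hd
      simp [hd]

/-- For every `D` containing `v`, adding `x` and removing `u` gives a low set, hence `y`. This is
the degenerate case in which a missed low set has no low neighbour. -/
theorem ncard_dominatingSets_le_three (huv : u ≠ v) (hu : ∀ w, H.Adj u w ↔ w = x)
    (hv : ∀ w, H.Adj v w ↔ w = x) (y : CenteredDominatingSet H v x)
    (h : ∀ z : CenteredDominatingSet H v x, u ∉ z.1 → z = y) :
    {D : Set V | IsDominatingSet H D ∧ v ∈ D}.ncard ≤ 3 := by
  have hux : u ≠ x := ((hu x).2 rfl).ne
  have hvx : v ≠ x := ((hv x).2 rfl).ne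
  have hsub : {D : Set V | IsDominatingSet H D ∧ v ∈ D} ⊆
      {y.1, insert u y.1, insert u y.1 \ {x}} := by
    rintro D ⟨hD, hvD⟩
    have hDy : insert x D \ {u} = y.1 := congrArg Subtype.val (h ⟨insert x D \ {u},
      hD.of_leaves hu hv ⟨by simp, hux.symm⟩ fun w hw h _ => ⟨by simp [hw], h⟩,
      ⟨by simp [hvD], huv.symm⟩, ⟨by simp, hux.symm⟩⟩ (by simp))
    rw [← hDy]
    by_cases huD : u ∈ D
    · have e : insert u (insert x D \ {u}) = insert x D := by
        simp [huD]
      rw [e]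
      by_cases hxD : x ∈ D
      · simp [hxD]
      · simp [hxD]
    · have hxD : x ∈ D := by
        by_contra hxD
        exact huD (hD.leaf_mem hu hxD)
      simp [hxD, huD]
  refine (Set.ncard_le_ncard hsub (by simp)).trans ?_
  refine (Set.ncard_insert_le _ _).trans (Nat.succ_le_succ ?_)
  exact (Set.ncard_insert_le _ _).trans (by simp)

/-- Adding the leaf `v` to the dominating sets of `H - v`. -/
def insertLeafHom {W : Type*} {H' : SimpleGraph W} (e : H' ≃g H.induce {w | w ≠ v}) :
    tarsGraph H' →g tarsGraph H where
  toFun D := ⟨insert v ((fun w => (e w).1) '' D.1), by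
    intro w hw
    simp only [Set.mem_insert_iff, not_or] at hw
    have hew : (e (e.symm ⟨w, hw.1⟩)).1 = w := by simp
    obtain ⟨d, hd, hwd⟩ := D.2 (e.symm ⟨w, hw.1⟩) fun h => hw.2 ⟨_, h, hew⟩
    refine ⟨(e d).1, Or.inr ⟨d, hd, rfl⟩, ?_⟩
    have := e.map_rel_iff.2 hwd
    rwa [comap_adj, Function.Embedding.subtype_apply, hew] at this⟩
  map_rel' := by
    have hmem : ∀ (D : Set W) (w : W), (e w).1 ∈ insert v ((fun w => (e w).1) '' D) ↔ w ∈ D := by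
      intro D w
      have h1 : (e w).1 ≠ v := (e w).2
      have h2 : ∀ w', (e w').1 = (e w).1 ↔ w' = w := fun w' => by
        rw [← Subtype.ext_iff, e.injective.eq_iff]
      simp [h1, h2]
    have hcases : ∀ z, z = v ∨ ∃ w, z = (e w).1 := fun z => by
      by_cases hz : z = v
      · exact Or.inl hz
      · exact Or.inr ⟨e.symm ⟨z, hz⟩, by simp⟩
    intro C D h
    rw [tarsGraph_adj_iff] at h ⊢
    rcases h with ⟨w, hw, h⟩ | ⟨a, b, h1, h2, h3, h4, h5, h6⟩
    · refine Or.inl ⟨(e w).1, by rwa [hmem, hmem], fun z hz => ?_⟩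
      rcases hcases z with rfl | ⟨w', rfl⟩
      · simp
      · rw [hmem, hmem]
        exact h w' fun h' => hz (by rw [h'])
    · refine Or.inr ⟨(e a).1, (e b).1, by rwa [hmem], by rwa [hmem], by rwa [hmem], by rwa [hmem],
        e.map_rel_iff.2 h5, fun z hz hz' => ?_⟩
      rcases hcases z with rfl | ⟨w', rfl⟩
      · simp
      · rw [hmem, hmem]
        exact h6 w' (fun h' => hz (by rw [h'])) fun h' => hz' (by rw [h'])

theorem insertLeafHom_injective {W : Type*} {H' : SimpleGraph W}
    (e : H' ≃g H.induce {w | w ≠ v}) : Function.Injective (insertLeafHom e) := by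
  intro C D h
  have h' : insert v ((fun w => (e w).1) '' C.1) = insert v ((fun w => (e w).1) '' D.1) :=
    congrArg Subtype.val h
  refine Subtype.ext (Set.ext fun w => ?_)
  have h1 : (e w).1 ≠ v := (e w).2
  have h2 : ∀ w', (e w').1 = (e w).1 ↔ w' = w := fun w' => by
    rw [← Subtype.ext_iff, e.injective.eq_iff]
  simpa [h1, h2] using Set.ext_iff.1 h' (e w).1

theorem mem_range_insertLeafHom {W : Type*} {H' : SimpleGraph W} (huv : u ≠ v)
    (hu : ∀ w, H.Adj u w ↔ w = x) (hv : ∀ w, H.Adj v w ↔ w = x)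
    (e : H' ≃g H.induce {w | w ≠ v}) (D : {D : Set V // IsDominatingSet H D}) :
    D ∈ Set.range (insertLeafHom e) ↔ v ∈ D.1 := by
  refine ⟨?_, fun hvD => ⟨⟨{w | (e w).1 ∈ D.1}, fun w hw => ?_⟩, Subtype.ext (Set.ext fun z => ?_)⟩⟩
  · rintro ⟨C, rfl⟩
    exact Or.inl rfl
  · have hex : ∃ d ∈ D.1, d ≠ v ∧ H.Adj (e w).1 d := by
      obtain ⟨d, hd, hwd⟩ := D.2 _ hw
      by_cases hdv : d = v
      · have hwx : (e w).1 = x := (hv _).1 (hdv ▸ hwd.symm)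
        refine ⟨u, D.2.leaf_mem hu (hwx ▸ hw), huv, ?_⟩
        rw [hwx]
        exact ((hu x).2 rfl).symm
      · exact ⟨d, hd, hdv, hwd⟩
    obtain ⟨d, hd, hdv, hwd⟩ := hex
    refine ⟨e.symm ⟨d, hdv⟩, by simpa using hd, ?_⟩
    rw [← e.map_rel_iff]
    simpa using hwd
  · change z ∈ insert v ((fun w => (e w).1) '' {w | (e w).1 ∈ D.1}) ↔ z ∈ D.1
    by_cases hz : z = v
    · simp [hz, hvD]
    · simp only [Set.mem_insert_iff, hz, false_or, Set.mem_image]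
      refine ⟨?_, fun h => ⟨e.symm ⟨z, hz⟩, by simpa using h, by simp⟩⟩
      rintro ⟨w, hw, rfl⟩
      exact hw

end TwinLeaves

/-! ### Counting and parity -/

theorem mainTheorem4 {V W : Type*} [Finite V] [Finite W]
    (H : SimpleGraph V) (H' : SimpleGraph W) (hB : IsOperationB H H')
    (hH' : IsPancyclic (tarsGraph H')) :
    IsPancyclic (tarsGraph H) := by
  classical
  obtain ⟨u, v, x, huv, hu, hv, ⟨e⟩⟩ := hB
  replace hu : ∀ w, H.Adj u w ↔ w = x := fun w => by
    rw [← mem_neighborSet, hu, Set.mem_singleton_iff]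
  replace hv : ∀ w, H.Adj v w ↔ w = x := fun w => by
    rw [← mem_neighborSet, hv, Set.mem_singleton_iff]
  have hux : u ≠ x := ((hu x).2 rfl).ne
  have hvx : v ≠ x := ((hv x).2 rfl).ne
  set L := twinLeavesDoubleLayer huv hu hv
  set f := insertLeafHom e
  have hfinj : Function.Injective f := insertLeafHom_injective e
  have hrange : ∀ D, D ∈ Set.range f ↔ v ∈ D.1 := mem_range_insertLeafHom huv hu hv e
  have := Fintype.ofFinite (CenteredDominatingSet H v x)
  have hκv : ∀ D, D ∈ Set.range L.κ ↔ v ∉ D.1 := by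
    intro D
    constructor
    · rintro ⟨p, rfl⟩
      exact fun h => h.2 rfl
    · intro h
      have hxD : x ∈ D.1 := by
        by_contra hxD
        exact h (D.2.leaf_mem hv hxD)
      refine ⟨⟨insert v D.1, D.2.of_leaves hu hv (by simp [hxD]) (fun z hz _ _ => by simp [hz]),
        by simp, by simp [hxD]⟩, Subtype.ext ?_⟩
      change insert v D.1 \ {v} = D.1
      simp [h]
  have hιx : ∀ D, D ∈ Set.range L.ι → x ∈ D.1 := by
    rintro _ ⟨p, rfl⟩
    exact p.2.2.2
  have hιv : ∀ p, v ∈ (L.ι p).1 := fun p => p.2.2.1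
  have hbdom : IsDominatingSet H {x}ᶜ := by
    intro w hw
    obtain rfl : w = x := by simpa using hw
    exact ⟨u, hux, ((hu w).2 rfl).symm⟩
  have hb : ∃ b, b ∉ Set.range L.ι ∧ b ∉ Set.range L.κ :=
    ⟨⟨{x}ᶜ, hbdom⟩, fun h => hιx _ h rfl, fun h => (hκv _).1 h hvx⟩
  let p₀ : CenteredDominatingSet H v x :=
    ⟨Set.univ, fun w hw => absurd trivial hw, trivial, trivial⟩
  have hcardX : 2 ≤ Fintype.card (CenteredDominatingSet H v x) :=
    Fintype.one_lt_card_iff.2 ⟨_, _, L.τ_ne p₀⟩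
  have heven : Even (Fintype.card (CenteredDominatingSet H v x)) := L.even_card
  have hrcard : Nat.card {D : Set W // IsDominatingSet H' D} = (Set.range f).ncard := by
    rw [← Set.image_univ, Set.ncard_image_of_injective _ hfinj, Set.ncard_univ]
  -- The extra set is `{x}ᶜ`. With `hcardX` this gives `n ≥ 3`.
  have hcard' : Fintype.card (CenteredDominatingSet H v x) + 1 ≤
      Nat.card {D : Set W // IsDominatingSet H' D} := by
    obtain ⟨b, hbι, hbκ⟩ := hb
    have h1 : (Set.range L.ι).ncard = Fintype.card (CenteredDominatingSet H v x) := by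
      rw [← Set.image_univ, Set.ncard_image_of_injective _ L.ι_injective, Set.ncard_univ,
        Nat.card_eq_fintype_card]
    rw [hrcard, ← h1, ← Set.ncard_insert_of_notMem hbι]
    refine Set.ncard_le_ncard ?_
    rintro D (rfl | ⟨p, rfl⟩)
    · exact (hrange _).2 (not_not.1 fun h => hbκ ((hκv _).2 h))
    · exact (hrange _).2 (hιv p)
  have hcard : Nat.card {D : Set V // IsDominatingSet H D} ≤
      Nat.card {D : Set W // IsDominatingSet H' D} + Fintype.card (CenteredDominatingSet H v x) := by
    rw [← Nat.card_eq_fintype_card, ← Nat.card_sum]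
    refine Nat.card_le_card_of_surjective (Sum.elim f L.κ) fun D => ?_
    by_cases hD : v ∈ D.1
    · obtain ⟨C, hC⟩ := (hrange D).2 hD
      exact ⟨Sum.inl C, hC⟩
    · obtain ⟨C, hC⟩ := (hκv D).2 hD
      exact ⟨Sum.inr C, hC⟩
  have hncard : Nat.card {D : Set W // IsDominatingSet H' D} =
      {D : Set V | IsDominatingSet H D ∧ v ∈ D}.ncard := by
    rw [hrcard, ← Set.ncard_image_of_injective _ Subtype.val_injective]
    congr 1
    ext D
    simp only [Set.mem_image, hrange, Subtype.exists, Set.mem_ofPred_eq, exists_and_right,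
      exists_eq_right]
    exact ⟨fun ⟨h, h'⟩ => ⟨h, h'⟩, fun ⟨h, h'⟩ => ⟨h, h'⟩⟩
  have extend : ∀ (a : _) (c : (tarsGraph H').Walk a a), c.IsCycle →
      Nat.card {D : Set W // IsDominatingSet H' D} ≤ c.length + 1 →
      (Nat.card {D : Set W // IsDominatingSet H' D} ≤ c.length ∨
        3 < Nat.card {D : Set W // IsDominatingSet H' D}) →
      ∀ j, 2 * j ≤ Fintype.card (CenteredDominatingSet H v x) → ∃ (b : _) (d : (tarsGraph H).Walk b b), d.IsCycle ∧
        d.length = c.length + 2 * j := by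
    intro a c hc hlen h3 j hj
    have hsupp : ∀ D, D ∈ (c.map f).support ↔ ∃ C ∈ c.support, f C = D := by simp
    have := L.exists_isCycle (hc.map hfinj) (fun p hp => ?_) (fun D D' h1 h2 h3 h4 => ?_) hb ?_ hj
    · simpa using this
    · obtain ⟨C, -, hC⟩ := (hsupp _).1 hp
      exact (hκv _).1 ⟨p, rfl⟩ ((hrange _).1 ⟨C, hC⟩)
    · obtain ⟨C, rfl⟩ := (hrange D).2 (not_not.1 fun h => h1 ((hκv D).2 h))
      obtain ⟨C', rfl⟩ := (hrange D').2 (not_not.1 fun h => h2 ((hκv D').2 h))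
      by_contra hne
      have hCC : C ≠ C' := fun h => hne (by rw [h])
      have hle := hc.card_add_length_le {C, C'} fun y hy hyc => by
        rcases Finset.mem_insert.1 hy with rfl | hy
        · exact h3 ((hsupp _).2 ⟨_, hyc, rfl⟩)
        · exact h4 ((hsupp _).2 ⟨_, hyc, by rw [Finset.mem_singleton.1 hy]⟩)
      rw [Finset.card_pair hCC] at hle
      omega
    · intro y hy hlow
      obtain ⟨C, hC⟩ := (hrange _).2 (hιv y)
      have hle := hc.card_add_length_le {C} fun C' hC' hC'c =>
        hy ((hsupp _).2 ⟨C', hC'c, by rw [Finset.mem_singleton.1 hC', hC]⟩)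
      rw [Finset.card_singleton] at hle
      by_cases hall : ∀ z : CenteredDominatingSet H v x, u ∉ z.1 → z = y
      · have := ncard_dominatingSets_le_three huv hu hv y hall
        omega
      · push Not at hall
        obtain ⟨z, hz, hzy⟩ := hall
        exact exists_low_adj hu hv hzy hlow hz
  intro ℓ hℓ3 hℓ
  set n := Nat.card {D : Set W // IsDominatingSet H' D} with hn
  by_cases hℓn : ℓ ≤ n
  · obtain ⟨a, c, hc, rfl⟩ := hH' ℓ hℓ3 hℓn
    exact ⟨_, c.map f, hc.map hfinj, by simp⟩
  obtain ⟨m, hm⟩ := heven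
  rcases Nat.even_or_odd' (ℓ - n) with ⟨j, hj | hj⟩
  · obtain ⟨a, c, hc, hl⟩ := hH' n (by omega) le_rfl
    obtain ⟨b, d, hd, hdl⟩ := extend a c hc (by omega) (Or.inl (by omega)) j (by omega)
    exact ⟨b, d, hd, by omega⟩
  · by_cases h3 : n ≤ 3
    -- Here `n = 3` and `X` has two elements, so at most five sets exist and 4 is the only length of
    -- this parity. No cycle of length `n - 1 = 2` exists, and a square of the two layers serves
    -- instead.
    · obtain rfl : ℓ = 4 := by omega
      exact L.exists_isCycle_length_four p₀
    · obtain ⟨a, c, hc, hl⟩ := hH' (n - 1) (by omega) (by omega)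
      -- `ℓ = (n - 1) + 2 * (j + 1)`, and `j + 1` rungs are available because `X` has even size.
      obtain ⟨b, d, hd, hdl⟩ := extend a c hc (by omega) (Or.inr (by omega)) (j + 1) (by omega)
      exact ⟨b, d, hd, by omega⟩
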